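/- Let $\mathbb K=\mathbb R$ or $\mathbb K=\mathbb C$, and let $a_1,a_2\in\mathbb K$ satisfy $a_1\neq a_2$ and $a_1\neq -a_2$. Then the Painlevé II equations $y''=2y^3+xy+a_1$ and $y''=2y^3+xy+a_2$ are not equivalent under point transformations, not even locally: there are no nonempty open set $U\subseteq\mathbb K^2$ and no smooth (holomorphic if $\mathbb K=\mathbb C$) change of variables $\tilde x=\tilde x(x,y)$, $\tilde y=\tilde y(x,y)$ on $U$ with nowhere vanishing Jacobian determinant that transforms the equation $y''=2y^3+xy+a_1$ over $U$ into the equation $\tilde y''=2\tilde y^3+\tilde x\tilde y+a_2$. Here "transforms" means: for all $(x,y)\in U$ and all values $y',y''\in\mathbb K$ with $\frac{d\tilde x}{dx}=\tilde x_x+y'\tilde x_y\neq 0$, the first equation holds for $(x,y,y',y'')$ if and only if the second holds for $\tilde x,\tilde y$ and the derivatives $\tilde y'=\frac{d\tilde y}{d\tilde x}$, $\tilde y''=\frac{d^2\tilde y}{d\tilde x^2}$ computed from $(x,y,y',y'')$ by the chain rule. -/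

import Mathlib

open scoped ContDiff

/-- An ordinary differential equation
`y'' = P(x,y) + 3 Q(x,y) y' + 3 R(x,y) y'^2 + S(x,y) y'^3`,
given by its four coefficient functions on the `(x,y)`-plane. -/
structure CubicODE (𝕜 : Type*) where
  P : 𝕜 × 𝕜 → 𝕜
  Q : 𝕜 × 𝕜 → 𝕜
  R : 𝕜 × 𝕜 → 𝕜
  S : 𝕜 × 𝕜 → 𝕜

/-- The right-hand side of the equation at the point `z = (x,y)`, with `y' = p`. -/
def CubicODE.rhs {𝕜 : Type*} [RCLike 𝕜] (E : CubicODE 𝕜) (z : 𝕜 × 𝕜) (p : 𝕜) : 𝕜 :=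
  E.P z + 3 * E.Q z * p + 3 * E.R z * p ^ 2 + E.S z * p ^ 3

/-- The second Painlevé equation `y'' = 2 y^3 + x y + a`. -/
def painleveII {𝕜 : Type*} [RCLike 𝕜] (a : 𝕜) : CubicODE 𝕜 where
  P z := 2 * z.2 ^ 3 + z.1 * z.2 + a
  Q _ := 0
  R _ := 0
  S _ := 0

/-- First total derivative of a change of variables `Φ = (x̃, ỹ)`: the pair
`(dx̃/dx, dỹ/dx)` along a graph through `z = (x,y)` with slope `y' = p`. -/
noncomputable def totalDeriv {𝕜 : Type*} [RCLike 𝕜] (Φ : 𝕜 × 𝕜 → 𝕜 × 𝕜)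
    (z : 𝕜 × 𝕜) (p : 𝕜) : 𝕜 × 𝕜 :=
  fderiv 𝕜 Φ z (1, p)

/-- Second total derivative of `Φ = (x̃, ỹ)`: the pair `(d²x̃/dx², d²ỹ/dx²)` along a graph through
`z = (x,y)` with `y' = p` and `y'' = q`, that is,
`Φ_xx + 2 p Φ_xy + p² Φ_yy + q Φ_y`. -/
noncomputable def totalDeriv₂ {𝕜 : Type*} [RCLike 𝕜] (Φ : 𝕜 × 𝕜 → 𝕜 × 𝕜)
    (z : 𝕜 × 𝕜) (p q : 𝕜) : 𝕜 × 𝕜 :=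
  fderiv 𝕜 (fderiv 𝕜 Φ) z (1, p) (1, p) + fderiv 𝕜 Φ z (0, q)

/-- The value of `dỹ/dx̃` in the new variables (meaningful where `dx̃/dx ≠ 0`). -/
noncomputable def newSlope {𝕜 : Type*} [RCLike 𝕜] (Φ : 𝕜 × 𝕜 → 𝕜 × 𝕜)
    (z : 𝕜 × 𝕜) (p : 𝕜) : 𝕜 :=
  (totalDeriv Φ z p).2 / (totalDeriv Φ z p).1

/-- The value of `d²ỹ/dx̃²` in the new variables (meaningful where `dx̃/dx ≠ 0`). -/
noncomputable def newSecond {𝕜 : Type*} [RCLike 𝕜] (Φ : 𝕜 × 𝕜 → 𝕜 × 𝕜)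
    (z : 𝕜 × 𝕜) (p q : 𝕜) : 𝕜 :=
  ((totalDeriv₂ Φ z p q).2 * (totalDeriv Φ z p).1
      - (totalDeriv Φ z p).2 * (totalDeriv₂ Φ z p q).1) / (totalDeriv Φ z p).1 ^ 3

/-- A point transformation `(x,y) ↦ (x̃(x,y), ỹ(x,y))` on an open set `U` of the plane: smooth
(holomorphic when `𝕜 = ℂ`) and with nowhere vanishing Jacobian determinant. -/
structure IsPointTransformation {𝕜 : Type*} [RCLike 𝕜] (Φ : 𝕜 × 𝕜 → 𝕜 × 𝕜)
    (U : Set (𝕜 × 𝕜)) : Prop where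
  isOpen : IsOpen U
  contDiffOn : ContDiffOn 𝕜 ∞ Φ U
  det_ne_zero : ∀ z ∈ U, (fderiv 𝕜 Φ z).det ≠ 0

/-- `Φ` carries the equation `E₁` over `U` to the equation `E₂`: for every `(x,y) ∈ U` and all values
`p`, `q` of `y'`, `y''` for which `x̃` can serve as the new independent variable, the equation
`E₁` holds for `(x,y,p,q)` if and only if `E₂` holds for the transformed values. -/
def Transforms {𝕜 : Type*} [RCLike 𝕜] (Φ : 𝕜 × 𝕜 → 𝕜 × 𝕜) (U : Set (𝕜 × 𝕜))
    (E₁ E₂ : CubicODE 𝕜) : Prop :=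
  ∀ z ∈ U, ∀ p q : 𝕜, (totalDeriv Φ z p).1 ≠ 0 →
    (q = E₁.rhs z p ↔ newSecond Φ z p q = E₂.rhs (Φ z) (newSlope Φ z p))

/-- Two equations are (locally) equivalent under point transformations if some point transformation,
defined on a nonempty open subset of the plane, carries the first to the second. -/
def PointEquivalent {𝕜 : Type*} [RCLike 𝕜] (E₁ E₂ : CubicODE 𝕜) : Prop :=
  ∃ (U : Set (𝕜 × 𝕜)) (Φ : 𝕜 × 𝕜 → 𝕜 × 𝕜),
    U.Nonempty ∧ IsPointTransformation Φ U ∧ Transforms Φ U E₁ E₂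

/-! Write a point transformation as `(u, v)`, with Jacobian `J`, and let `F = 2v³ + uv + a₂`.
Comparing powers of `y'` gives four PDEs for `u` and `v`. The three without the source's right-hand
side, together with the derivatives of `J`, express `u_xy`, `u_yy`, `v_xy`, `v_yy` through first
derivatives and `d log J`. Cross-differentiating this system twice leaves the obstruction `F_vv J
u_y = 12 v J u_y = 0`, hence `v u_y = 0` (`snd_mul_dirDeriv_eq_zero`). As `J ≠ 0`, `v` cannot vanish
identically on `U`, so `u_y = 0` on the nonempty open set where `v ≠ 0`. There `u` varies with `x`
alone and `v` is affine in `y`; matching powers of `y` in the remaining PDE forces `v = y v_y` with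
`v_y`, `u_x` locally constant, `u_x³ = 1` and `(v_y u_x)² = 1`. The constant term then reads `a₂ =
±a₁` (`eq_or_eq_neg_of_dirDeriv_eq_zero`). -/

/-- The derivative of `g` at `z` in the direction `w`. -/
noncomputable def dirDeriv {𝕜 : Type*} [RCLike 𝕜] (w : 𝕜 × 𝕜) (g : 𝕜 × 𝕜 → 𝕜)
    (z : 𝕜 × 𝕜) : 𝕜 :=
  fderiv 𝕜 g z w

/-- `g` is differentiable at `z` and its derivative in the direction `w` is `d`. -/
def HasDirDeriv {𝕜 : Type*} [RCLike 𝕜] (w : 𝕜 × 𝕜) (g : 𝕜 × 𝕜 → 𝕜) (d : 𝕜)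
    (z : 𝕜 × 𝕜) : Prop :=
  DifferentiableAt 𝕜 g z ∧ dirDeriv w g z = d

local notation "∂x" => dirDeriv (1, 0)
local notation "∂y" => dirDeriv (0, 1)

/-! ### Calculus of directional derivatives. -/

section DirDeriv

variable {𝕜 : Type*} [RCLike 𝕜] {w w' z : 𝕜 × 𝕜} {g h : 𝕜 × 𝕜 → 𝕜} {d e : 𝕜} {U : Set (𝕜 × 𝕜)}

theorem HasDirDeriv.add (hg : HasDirDeriv w g d z) (hh : HasDirDeriv w h e z) :
    HasDirDeriv w (fun x => g x + h x) (d + e) z := by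
  refine ⟨hg.1.add hh.1, ?_⟩
  rw [← hg.2, ← hh.2]
  simp [dirDeriv, fderiv_fun_add hg.1 hh.1]

theorem HasDirDeriv.sub (hg : HasDirDeriv w g d z) (hh : HasDirDeriv w h e z) :
    HasDirDeriv w (fun x => g x - h x) (d - e) z := by
  refine ⟨hg.1.sub hh.1, ?_⟩
  rw [← hg.2, ← hh.2]
  simp [dirDeriv, fderiv_fun_sub hg.1 hh.1]

theorem HasDirDeriv.mul (hg : HasDirDeriv w g d z) (hh : HasDirDeriv w h e z) :
    HasDirDeriv w (fun x => g x * h x) (d * h z + g z * e) z := by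
  refine ⟨hg.1.mul hh.1, ?_⟩
  rw [← hg.2, ← hh.2]
  simp [dirDeriv, fderiv_fun_mul hg.1 hh.1]
  ring

theorem hasDirDeriv_const (c : 𝕜) : HasDirDeriv w (fun _ => c) 0 z :=
  ⟨differentiableAt_const c, by simp [dirDeriv]⟩

theorem HasDirDeriv.const_mul (c : 𝕜) (hg : HasDirDeriv w g d z) :
    HasDirDeriv w (fun x => c * g x) (c * d) z := by
  simpa using (hasDirDeriv_const c).mul hg

theorem HasDirDeriv.pow_two (hg : HasDirDeriv w g d z) :
    HasDirDeriv w (fun x => g x ^ 2) (2 * g z * d) z := by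
  have := hg.mul hg
  simp only [← sq] at this
  convert this using 1
  ring

theorem HasDirDeriv.pow_three (hg : HasDirDeriv w g d z) :
    HasDirDeriv w (fun x => g x ^ 3) (3 * g z ^ 2 * d) z := by
  have := hg.pow_two.mul hg
  simp only [← pow_succ] at this
  convert this using 1
  ring

theorem hasDirDeriv_fst : HasDirDeriv w Prod.fst w.1 z :=
  ⟨differentiableAt_fst, by simp [dirDeriv, fderiv_fst]⟩

theorem hasDirDeriv_snd : HasDirDeriv w Prod.snd w.2 z :=
  ⟨differentiableAt_snd, by simp [dirDeriv, fderiv_snd]⟩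

/-- The device for differentiating an identity valid on `U`: both sides are differentiated by the
rules above and the results equated. -/
theorem HasDirDeriv.unique_of_eqOn (hU : IsOpen U) (hz : z ∈ U) (hgh : Set.EqOn g h U)
    (hg : HasDirDeriv w g d z) (hh : HasDirDeriv w h e z) : d = e := by
  rw [← hg.2, ← hh.2, dirDeriv, dirDeriv, (hgh.eventuallyEq_of_mem (hU.mem_nhds hz)).fderiv_eq]

theorem ContDiffOn.hasDirDeriv (hg : ContDiffOn 𝕜 ∞ g U) (hU : IsOpen U) (w : 𝕜 × 𝕜)
    (hz : z ∈ U) : HasDirDeriv w g (dirDeriv w g z) z :=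
  ⟨(hg.contDiffAt (hU.mem_nhds hz)).differentiableAt (by simp), rfl⟩

theorem ContDiffOn.dirDeriv (hg : ContDiffOn 𝕜 ∞ g U) (hU : IsOpen U) (w : 𝕜 × 𝕜) :
    ContDiffOn 𝕜 ∞ (dirDeriv w g) U :=
  (hg.fderiv_of_isOpen hU (m := ∞) (by simp)).clm_apply contDiffOn_const

theorem dirDeriv_dirDeriv (hg : ContDiffOn 𝕜 ∞ g U) (hU : IsOpen U) (hz : z ∈ U) :
    dirDeriv w (dirDeriv w' g) z = fderiv 𝕜 (fderiv 𝕜 g) z w w' := by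
  have h : DifferentiableAt 𝕜 (fderiv 𝕜 g) z :=
    ((hg.fderiv_of_isOpen hU (m := ∞) (by simp)).contDiffAt (hU.mem_nhds hz)).differentiableAt
      (by simp)
  change fderiv 𝕜 (fun x => fderiv 𝕜 g x w') z w = _
  rw [fderiv_clm_apply h (differentiableAt_const _)]
  simp

theorem dirDeriv_comm (hg : ContDiffOn 𝕜 ∞ g U) (hU : IsOpen U) (hz : z ∈ U) :
    dirDeriv w (dirDeriv w' g) z = dirDeriv w' (dirDeriv w g) z := by
  rw [dirDeriv_dirDeriv hg hU hz, dirDeriv_dirDeriv hg hU hz]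
  exact ((hg.contDiffAt (hU.mem_nhds hz)).isSymmSndFDerivAt
    (by simpa using WithTop.coe_le_coe.mpr (le_top : (2 : ℕ∞) ≤ ⊤))) w w'

theorem dirDeriv_eq_zero_of_eqOn (hU : IsOpen U) (hz : z ∈ U) (hg : Set.EqOn g (fun _ => d) U) :
    dirDeriv w g z = 0 := by
  rw [dirDeriv, (hg.eventuallyEq_of_mem (hU.mem_nhds hz)).fderiv_eq]
  simp

end DirDeriv

/-! ### Analysis of the transformation equations. -/

/-- The Jacobian determinant of `(u, v)`. -/
noncomputable def jacobianDet {𝕜 : Type*} [RCLike 𝕜] (u v : 𝕜 × 𝕜 → 𝕜) (z : 𝕜 × 𝕜) : 𝕜 :=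
  ∂x u z * ∂y v z - ∂y u z * ∂x v z

/-- The partial differential equations expressing that `(x, y) ↦ (u, v)` carries `y'' = f` to
`v'' = F`, where `f` and `F` are both viewed as functions of `(x, y)`. -/
structure TransformationEqs {𝕜 : Type*} [RCLike 𝕜] (u v f F : 𝕜 × 𝕜 → 𝕜) (z : 𝕜 × 𝕜) :
    Prop where
  coeff_zero : ∂x (∂x v) z * ∂x u z - ∂x v z * ∂x (∂x u) z
    + f z * (∂y v z * ∂x u z - ∂x v z * ∂y u z) = F z * ∂x u z ^ 3
  coeff_one : 2 * ∂x (∂y v) z * ∂x u z + ∂x (∂x v) z * ∂y u z - 2 * ∂x v z * ∂x (∂y u) z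
    - ∂y v z * ∂x (∂x u) z = 3 * F z * ∂x u z ^ 2 * ∂y u z
  coeff_two : ∂y (∂y v) z * ∂x u z + 2 * ∂x (∂y v) z * ∂y u z - ∂x v z * ∂y (∂y u) z
    - 2 * ∂y v z * ∂x (∂y u) z = 3 * F z * ∂x u z * ∂y u z ^ 2
  coeff_three : ∂y (∂y v) z * ∂y u z - ∂y v z * ∂y (∂y u) z = F z * ∂y u z ^ 3

section Transformation

variable {𝕜 : Type*} [RCLike 𝕜] {u v f : 𝕜 × 𝕜 → 𝕜} {a₁ a₂ : 𝕜} {U : Set (𝕜 × 𝕜)}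

/-- An integrability condition of the overdetermined system for `u` and `v`. The source term `f` is
arbitrary, since `coeff_zero`, the only equation containing it, plays no part. -/
theorem snd_mul_dirDeriv_eq_zero (hU : IsOpen U) (hu : ContDiffOn 𝕜 ∞ u U)
    (hv : ContDiffOn 𝕜 ∞ v U) (hJ : ∀ z ∈ U, jacobianDet u v z ≠ 0)
    (hE : ∀ z ∈ U, TransformationEqs u v f (fun z => 2 * v z ^ 3 + u z * v z + a₂) z)
    {z : 𝕜 × 𝕜} (hz : z ∈ U) : v z * ∂y u z = 0 := by
  have hux := hu.dirDeriv hU (1, 0)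
  have huy := hu.dirDeriv hU (0, 1)
  have hvx := hv.dirDeriv hU (1, 0)
  have hvy := hv.dirDeriv hU (0, 1)
  have hJs : ContDiffOn 𝕜 ∞ (jacobianDet u v) U := (hux.mul hvy).sub (huy.mul hvx)
  set J := jacobianDet u v
  have hJx := hJs.dirDeriv hU (1, 0)
  have hJy := hJs.dirDeriv hU (0, 1)
  -- `(s, t)` is one third of the logarithmic gradient of `J`; with it the second derivatives below
  -- take a polynomial form. Being a gradient, it satisfies `s_y = t_x`.
  obtain ⟨s, hs⟩ : ∃ s : 𝕜 × 𝕜 → 𝕜, s = fun z => ∂x J z / (3 * J z) := ⟨_, rfl⟩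
  obtain ⟨t, ht⟩ : ∃ t : 𝕜 × 𝕜 → 𝕜, t = fun z => ∂y J z / (3 * J z) := ⟨_, rfl⟩
  have h3J : ∀ z ∈ U, 3 * J z ≠ 0 := fun z hz => mul_ne_zero (by norm_num) (hJ z hz)
  have hss : ContDiffOn 𝕜 ∞ s U := hs ▸ hJx.div (contDiffOn_const.mul hJs) h3J
  have hts : ContDiffOn 𝕜 ∞ t U := ht ▸ hJy.div (contDiffOn_const.mul hJs) h3J
  have hsJ : ∀ z ∈ U, ∂x J z = 3 * (s z * J z) := fun z hz => by
    have := h3J z hz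
    rw [hs]; field_simp [hJ z hz]
  have htJ : ∀ z ∈ U, ∂y J z = 3 * (t z * J z) := fun z hz => by
    have := h3J z hz
    rw [ht]; field_simp [hJ z hz]
  have hst : ∀ z ∈ U, ∂y s z = ∂x t z := fun z hz => by
    have h1 := HasDirDeriv.unique_of_eqOn hU hz hsJ (hJx.hasDirDeriv hU (0, 1) hz)
      (((hss.hasDirDeriv hU (0, 1) hz).mul (hJs.hasDirDeriv hU (0, 1) hz)).const_mul 3)
    have h2 := HasDirDeriv.unique_of_eqOn hU hz htJ (hJy.hasDirDeriv hU (1, 0) hz)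
      (((hts.hasDirDeriv hU (1, 0) hz).mul (hJs.hasDirDeriv hU (1, 0) hz)).const_mul 3)
    have h3 := dirDeriv_comm (w := (1, 0)) (w' := (0, 1)) hJs hU hz
    apply mul_left_cancel₀ (h3J z hz)
    linear_combination h2 - h1 - h3 + 3 * t z * hsJ z hz - 3 * s z * htJ z hz
  have hJ' : ∀ w, ∀ z ∈ U, dirDeriv w J z =
      dirDeriv w (∂x u) z * ∂y v z + ∂x u z * dirDeriv w (∂y v) z
        - (dirDeriv w (∂y u) z * ∂x v z + ∂y u z * dirDeriv w (∂x v) z) := fun w z hz =>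
    (((hux.hasDirDeriv hU w hz).mul (hvy.hasDirDeriv hU w hz)).sub
      ((huy.hasDirDeriv hU w hz).mul (hvx.hasDirDeriv hU w hz))).2
  have hcu : ∀ z ∈ U, ∂y (∂x u) z = ∂x (∂y u) z := fun z hz => dirDeriv_comm hu hU hz
  have hcv : ∀ z ∈ U, ∂y (∂x v) z = ∂x (∂y v) z := fun z hz => dirDeriv_comm hv hU hz
  have hJv : ∀ z, J z = ∂x u z * ∂y v z - ∂y u z * ∂x v z := fun z => rfl
  -- Cramer's rule: `coeff_one` to `coeff_three` and the expansions of `J_x`, `J_y` are linear in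
  -- the second derivatives, with determinants built from `J`.
  have huyy : ∀ z ∈ U, ∂y (∂y u) z = 2 * (t z * ∂y u z) := fun z hz => by
    apply mul_left_cancel₀ (h3J z hz)
    have h1 := hJ' (0, 1) z hz
    rw [hcu z hz, hcv z hz] at h1
    obtain ⟨e0, e1, e2, e3⟩ := hE z hz
    linear_combination ∂y u z * e2 - 3 * ∂x u z * e3 + 2 * ∂y u z * (htJ z hz - h1)
      + 3 * ∂y (∂y u) z * hJv z
  have huxy : ∀ z ∈ U, ∂x (∂y u) z = s z * ∂y u z + t z * ∂x u z := fun z hz => by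
    apply mul_left_cancel₀ (h3J z hz)
    have h1 := hJ' (0, 1) z hz
    have h2 := hJ' (1, 0) z hz
    rw [hcu z hz, hcv z hz] at h1
    obtain ⟨e0, e1, e2, e3⟩ := hE z hz
    linear_combination ∂y u z * e1 - ∂x u z * e2 + ∂y u z * (hsJ z hz - h2)
      + ∂x u z * (htJ z hz - h1) + 3 * ∂x (∂y u) z * hJv z
  have hvyy : ∀ z ∈ U, ∂y (∂y v) z = 2 * (t z * ∂y v z)
      + (2 * v z ^ 3 + u z * v z + a₂) * ∂y u z ^ 2 := fun z hz => by
    apply mul_left_cancel₀ (h3J z hz)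
    have h1 := hJ' (0, 1) z hz
    rw [hcu z hz, hcv z hz] at h1
    obtain ⟨e0, e1, e2, e3⟩ := hE z hz
    linear_combination ∂y v z * e2 - 3 * ∂x v z * e3 + 2 * ∂y v z * (htJ z hz - h1)
      + (3 * ∂y (∂y v) z - 3 * (2 * v z ^ 3 + u z * v z + a₂) * ∂y u z ^ 2) * hJv z
  have hvxy : ∀ z ∈ U, ∂x (∂y v) z = s z * ∂y v z + t z * ∂x v z
      + (2 * v z ^ 3 + u z * v z + a₂) * (∂x u z * ∂y u z) := fun z hz => by
    apply mul_left_cancel₀ (h3J z hz)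
    have h1 := hJ' (0, 1) z hz
    have h2 := hJ' (1, 0) z hz
    rw [hcu z hz, hcv z hz] at h1
    obtain ⟨e0, e1, e2, e3⟩ := hE z hz
    linear_combination ∂y v z * e1 - ∂x v z * e2 + ∂y v z * (hsJ z hz - h2)
      + ∂x v z * (htJ z hz - h1)
      + (3 * ∂x (∂y v) z - 3 * (2 * v z ^ 3 + u z * v z + a₂) * ∂x u z * ∂y u z) * hJv z
  have hF : ∀ w, ∀ z ∈ U, HasDirDeriv w (fun z => 2 * v z ^ 3 + u z * v z + a₂) _ z :=
    fun w z hz => (((hv.hasDirDeriv hU w hz).pow_three.const_mul 2).add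
      ((hu.hasDirDeriv hU w hz).mul (hv.hasDirDeriv hU w hz))).add (hasDirDeriv_const a₂)
  -- Compatibility `∂x u_yy = ∂y u_xy`; `hcompv` is its analogue for `v`, where `F_v = 6v² + u`
  -- enters.
  have hcompu : ∀ z ∈ U, (∂y t z - t z ^ 2) * ∂x u z = (∂x t z - s z * t z) * ∂y u z :=
      fun z hz => by
    have h1 := HasDirDeriv.unique_of_eqOn hU hz huyy
      ((huy.dirDeriv hU (0, 1)).hasDirDeriv hU (1, 0) hz)
      (((hts.hasDirDeriv hU (1, 0) hz).mul (huy.hasDirDeriv hU (1, 0) hz)).const_mul 2)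
    have h2 := HasDirDeriv.unique_of_eqOn hU hz huxy
      ((huy.dirDeriv hU (1, 0)).hasDirDeriv hU (0, 1) hz)
      (((hss.hasDirDeriv hU (0, 1) hz).mul (huy.hasDirDeriv hU (0, 1) hz)).add
        ((hts.hasDirDeriv hU (0, 1) hz).mul (hux.hasDirDeriv hU (0, 1) hz)))
    have h3 := dirDeriv_comm (w := (1, 0)) (w' := (0, 1)) huy hU hz
    rw [hcu z hz] at h2
    rw [hst z hz, huxy z hz, huyy z hz] at h2
    rw [huxy z hz] at h1
    linear_combination h1 - h2 - h3
  have hcompv : ∀ z ∈ U, (∂y t z - t z ^ 2) * ∂x v z - (∂x t z - s z * t z) * ∂y v z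
      + (6 * v z ^ 2 + u z) * J z * ∂y u z = 0 := fun z hz => by
    have h1 := HasDirDeriv.unique_of_eqOn hU hz hvyy
      ((hvy.dirDeriv hU (0, 1)).hasDirDeriv hU (1, 0) hz)
      ((((hts.hasDirDeriv hU (1, 0) hz).mul (hvy.hasDirDeriv hU (1, 0) hz)).const_mul 2).add
        ((hF (1, 0) z hz).mul (huy.hasDirDeriv hU (1, 0) hz).pow_two))
    have h2 := HasDirDeriv.unique_of_eqOn hU hz hvxy
      ((hvy.dirDeriv hU (1, 0)).hasDirDeriv hU (0, 1) hz)
      ((((hss.hasDirDeriv hU (0, 1) hz).mul (hvy.hasDirDeriv hU (0, 1) hz)).add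
        ((hts.hasDirDeriv hU (0, 1) hz).mul (hvx.hasDirDeriv hU (0, 1) hz))).add
        ((hF (0, 1) z hz).mul
          ((hux.hasDirDeriv hU (0, 1) hz).mul (huy.hasDirDeriv hU (0, 1) hz))))
    have h3 := dirDeriv_comm (w := (1, 0)) (w' := (0, 1)) hvy hU hz
    rw [hcu z hz, hcv z hz, hvxy z hz, hvyy z hz] at h2
    rw [hst z hz, huxy z hz, huyy z hz] at h2
    rw [huxy z hz, hvxy z hz] at h1
    rw [hJv z]
    linear_combination h1 - h2 - h3
  -- The two compatibility conditions are linear in `t_x - st` and `t_y - t²` with determinant `±J`,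
  -- so they determine the gradient of `t`.
  have htx : ∀ z ∈ U, ∂x t z = s z * t z + (6 * v z ^ 2 + u z) * (∂x u z * ∂y u z) :=
      fun z hz => by
    apply mul_left_cancel₀ (hJ z hz)
    linear_combination - ∂x u z * hcompv z hz + ∂x v z * hcompu z hz
      + (∂x t z - s z * t z) * hJv z
  have hty : ∀ z ∈ U, ∂y t z = t z ^ 2 + (6 * v z ^ 2 + u z) * ∂y u z ^ 2 := fun z hz => by
    apply mul_left_cancel₀ (hJ z hz)
    linear_combination - ∂y u z * hcompv z hz + ∂y v z * hcompu z hz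
      + (∂y t z - t z ^ 2) * hJv z
  have hG : ∀ w, ∀ z ∈ U, HasDirDeriv w (fun z => 6 * v z ^ 2 + u z) _ z :=
    fun w z hz => ((hv.hasDirDeriv hU w hz).pow_two.const_mul 6).add (hu.hasDirDeriv hU w hz)
  -- In `∂y t_x = ∂x t_y` everything cancels except the derivative of `6v² + u`, which contributes
  -- `12 v J u_y`.
  have h1 := HasDirDeriv.unique_of_eqOn hU hz htx
    ((hts.dirDeriv hU (1, 0)).hasDirDeriv hU (0, 1) hz)
    (((hss.hasDirDeriv hU (0, 1) hz).mul (hts.hasDirDeriv hU (0, 1) hz)).add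
      ((hG (0, 1) z hz).mul ((hux.hasDirDeriv hU (0, 1) hz).mul (huy.hasDirDeriv hU (0, 1) hz))))
  have h2 := HasDirDeriv.unique_of_eqOn hU hz hty
    ((hts.dirDeriv hU (0, 1)).hasDirDeriv hU (1, 0) hz)
    ((hts.hasDirDeriv hU (1, 0) hz).pow_two.add
      ((hG (1, 0) z hz).mul (huy.hasDirDeriv hU (1, 0) hz).pow_two))
  have h3 := dirDeriv_comm (w := (1, 0)) (w' := (0, 1)) hts hU hz
  rw [hcu z hz, hst z hz, htx z hz, hty z hz, huxy z hz, huyy z hz] at h1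
  rw [htx z hz, huxy z hz] at h2
  apply mul_left_cancel₀ (mul_ne_zero (by norm_num : (12 : 𝕜) ≠ 0) (hJ z hz))
  linear_combination h2 - h1 - h3 + 12 * v z * ∂y u z * hJv z

/-- Once `u_y = 0`, `coeff_two` makes `v` affine in `y`, so `coeff_zero` is a polynomial identity in
`y` whose coefficients are extracted by repeated `∂y`. -/
theorem eq_or_eq_neg_of_dirDeriv_eq_zero (hU : IsOpen U) (hne : U.Nonempty)
    (hu : ContDiffOn 𝕜 ∞ u U) (hv : ContDiffOn 𝕜 ∞ v U) (hJ : ∀ z ∈ U, jacobianDet u v z ≠ 0)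
    (hE : ∀ z ∈ U, TransformationEqs u v (fun z => 2 * z.2 ^ 3 + z.1 * z.2 + a₁)
      (fun z => 2 * v z ^ 3 + u z * v z + a₂) z)
    (huy0 : ∀ z ∈ U, ∂y u z = 0) : a₁ = a₂ ∨ a₁ = -a₂ := by
  have hux := hu.dirDeriv hU (1, 0)
  have huy := hu.dirDeriv hU (0, 1)
  have hvx := hv.dirDeriv hU (1, 0)
  have hvy := hv.dirDeriv hU (0, 1)
  have huxx := hux.dirDeriv hU (1, 0)
  have hvxx := hvx.dirDeriv hU (1, 0)
  have hvxy := hvy.dirDeriv hU (1, 0)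
  have hux0 : ∀ z ∈ U, ∂x u z ≠ 0 := fun z hz h => hJ z hz (by
    simp [jacobianDet, h, huy0 z hz])
  have hvy0 : ∀ z ∈ U, ∂y v z ≠ 0 := fun z hz h => hJ z hz (by
    simp [jacobianDet, h, huy0 z hz])
  have huxy : ∀ z ∈ U, ∂x (∂y u) z = 0 := fun z hz => dirDeriv_eq_zero_of_eqOn hU hz huy0
  have huyy : ∀ z ∈ U, ∂y (∂y u) z = 0 := fun z hz => dirDeriv_eq_zero_of_eqOn hU hz huy0
  have hcu : ∀ z ∈ U, ∂y (∂x u) z = 0 := fun z hz =>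
    (dirDeriv_comm hu hU hz).trans (huxy z hz)
  have hcv : ∀ z ∈ U, ∂y (∂x v) z = ∂x (∂y v) z := fun z hz => dirDeriv_comm hv hU hz
  have huxxy : ∀ z ∈ U, ∂y (∂x (∂x u)) z = 0 := fun z hz =>
    (dirDeriv_comm hux hU hz).trans (dirDeriv_eq_zero_of_eqOn hU hz hcu)
  have hvyy : ∀ z ∈ U, ∂y (∂y v) z = 0 := fun z hz => by
    have h := (hE z hz).coeff_two
    simpa [huy0 z hz, huxy z hz, huyy z hz, hux0 z hz] using h
  have hvxyy : ∀ z ∈ U, ∂y (∂x (∂y v)) z = 0 := fun z hz =>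
    (dirDeriv_comm hvy hU hz).trans (dirDeriv_eq_zero_of_eqOn hU hz hvyy)
  have hvxxy : ∀ z ∈ U, ∂y (∂x (∂x v)) z = ∂x (∂x (∂y v)) z := fun z hz =>
    (dirDeriv_comm hvx hU hz).trans (HasDirDeriv.unique_of_eqOn hU hz hcv
      ((hvx.dirDeriv hU (0, 1)).hasDirDeriv hU (1, 0) hz) (hvxy.hasDirDeriv hU (1, 0) hz))
  have hvxxyy : ∀ z ∈ U, ∂y (∂x (∂x (∂y v))) z = 0 := fun z hz =>
    (dirDeriv_comm hvxy hU hz).trans (dirDeriv_eq_zero_of_eqOn hU hz hvxyy)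
  have hE0 : ∀ z ∈ U, ∂x (∂x v) z * ∂x u z - ∂x v z * ∂x (∂x u) z
      + (2 * z.2 ^ 3 + z.1 * z.2 + a₁) * (∂y v z * ∂x u z)
      = (2 * v z ^ 3 + u z * v z + a₂) * ∂x u z ^ 3 := fun z hz => by
    have h := (hE z hz).coeff_zero
    rw [huy0 z hz] at h
    linear_combination h
  have hE0y : ∀ z ∈ U, ∂x (∂x (∂y v)) z * ∂x u z - ∂x (∂y v) z * ∂x (∂x u) z
      + (6 * z.2 ^ 2 + z.1) * (∂y v z * ∂x u z)
      = (6 * v z ^ 2 + u z) * (∂y v z * ∂x u z ^ 3) := fun z hz => by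
    have h := HasDirDeriv.unique_of_eqOn hU hz hE0
      ((((hvxx.hasDirDeriv hU (0, 1) hz).mul (hux.hasDirDeriv hU (0, 1) hz)).sub
        ((hvx.hasDirDeriv hU (0, 1) hz).mul (huxx.hasDirDeriv hU (0, 1) hz))).add
        ((((hasDirDeriv_snd.pow_three.const_mul 2).add
          (hasDirDeriv_fst.mul hasDirDeriv_snd)).add (hasDirDeriv_const a₁)).mul
          ((hvy.hasDirDeriv hU (0, 1) hz).mul (hux.hasDirDeriv hU (0, 1) hz))))
      (((((hv.hasDirDeriv hU (0, 1) hz).pow_three.const_mul 2).add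
        ((hu.hasDirDeriv hU (0, 1) hz).mul (hv.hasDirDeriv hU (0, 1) hz))).add
        (hasDirDeriv_const a₂)).mul (hux.hasDirDeriv hU (0, 1) hz).pow_three)
    rw [hvxxy z hz, hcu z hz, hcv z hz, huxxy z hz, hvyy z hz, huy0 z hz] at h
    linear_combination h
  -- After a second `∂y` the terms with second derivatives of `u` and `v` vanish, leaving only the
  -- contribution of the cubes.
  have hy : ∀ z ∈ U, z.2 = v z * (∂y v z * ∂x u z ^ 2) := fun z hz => by
    have h := HasDirDeriv.unique_of_eqOn hU hz hE0y
      (((((hvxy.dirDeriv hU (1, 0)).hasDirDeriv hU (0, 1) hz).mul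
        (hux.hasDirDeriv hU (0, 1) hz)).sub
        ((hvxy.hasDirDeriv hU (0, 1) hz).mul (huxx.hasDirDeriv hU (0, 1) hz))).add
        (((hasDirDeriv_snd.pow_two.const_mul 6).add hasDirDeriv_fst).mul
          ((hvy.hasDirDeriv hU (0, 1) hz).mul (hux.hasDirDeriv hU (0, 1) hz))))
      ((((hv.hasDirDeriv hU (0, 1) hz).pow_two.const_mul 6).add (hu.hasDirDeriv hU (0, 1) hz)).mul
        ((hvy.hasDirDeriv hU (0, 1) hz).mul (hux.hasDirDeriv hU (0, 1) hz).pow_three))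
    rw [hvxxyy z hz, hcu z hz, hvxyy z hz, huxxy z hz, hvyy z hz, huy0 z hz] at h
    apply mul_left_cancel₀ (mul_ne_zero (by norm_num : (12 : 𝕜) ≠ 0)
      (mul_ne_zero (hvy0 z hz) (hux0 z hz)))
    linear_combination h
  have hone : ∀ z ∈ U, (1 : 𝕜) = ∂y v z ^ 2 * ∂x u z ^ 2 := fun z hz => by
    have h := HasDirDeriv.unique_of_eqOn hU hz hy hasDirDeriv_snd
      ((hv.hasDirDeriv hU (0, 1) hz).mul
        ((hvy.hasDirDeriv hU (0, 1) hz).mul (hux.hasDirDeriv hU (0, 1) hz).pow_two))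
    rw [hcu z hz, hvyy z hz] at h
    linear_combination h
  have hv_eq : ∀ z ∈ U, v z = z.2 * ∂y v z := fun z hz => by
    linear_combination v z * hone z hz - ∂y v z * hy z hz
  -- `coeff_one` now says `2 u_x v_xy = v_y u_xx`, while `∂x` of `hone` gives a second relation
  -- between `v_xy` and `u_xx`; together they force `v_xy = 0`.
  have hconst : ∀ z ∈ U, ∂x (∂y v) z = 0 := fun z hz => by
    have h := HasDirDeriv.unique_of_eqOn hU hz hone (hasDirDeriv_const 1)
      ((hvy.hasDirDeriv hU (1, 0) hz).pow_two.mul (hux.hasDirDeriv hU (1, 0) hz).pow_two)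
    have h1 := (hE z hz).coeff_one
    rw [huy0 z hz, huxy z hz] at h1
    have hne : 6 * ∂y v z * ∂x u z ^ 2 ≠ 0 :=
      mul_ne_zero (mul_ne_zero (by norm_num) (hvy0 z hz)) (pow_ne_zero 2 (hux0 z hz))
    apply mul_left_cancel₀ hne
    linear_combination 2 * ∂y v z * ∂x u z * h1 - h
  have huxx0 : ∀ z ∈ U, ∂x (∂x u) z = 0 := fun z hz => by
    have h1 := (hE z hz).coeff_one
    simpa [huy0 z hz, huxy z hz, hconst z hz, hvy0 z hz] using h1
  have hvx0 : ∀ z ∈ U, ∂x v z = 0 := fun z hz => by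
    have h := HasDirDeriv.unique_of_eqOn hU hz hv_eq (hv.hasDirDeriv hU (1, 0) hz)
      (hasDirDeriv_snd.mul (hvy.hasDirDeriv hU (1, 0) hz))
    simpa [hconst z hz] using h
  have hvxx0 : ∀ z ∈ U, ∂x (∂x v) z = 0 := fun z hz => dirDeriv_eq_zero_of_eqOn hU hz hvx0
  have hlin : ∀ z ∈ U, z.1 = ∂x u z ^ 2 * u z := fun z hz => by
    have h := hE0y z hz
    have h2 := dirDeriv_eq_zero_of_eqOn (w := (1, 0)) hU hz hconst
    rw [h2, hconst z hz] at h
    apply mul_left_cancel₀ (mul_ne_zero (hvy0 z hz) (hux0 z hz))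
    rw [hv_eq z hz] at h
    linear_combination h - 6 * z.2 ^ 2 * ∂y v z * ∂x u z * hone z hz
  have hcube : ∀ z ∈ U, (1 : 𝕜) = ∂x u z ^ 3 := fun z hz => by
    have h := HasDirDeriv.unique_of_eqOn hU hz hlin hasDirDeriv_fst
      ((hux.hasDirDeriv hU (1, 0) hz).pow_two.mul (hu.hasDirDeriv hU (1, 0) hz))
    rw [huxx0 z hz] at h
    linear_combination h
  obtain ⟨z, hz⟩ := hne
  have h := hE0 z hz
  rw [hvx0 z hz, hvxx0 z hz, hv_eq z hz] at h
  -- With `v = y v_y`, the cubic and linear terms of `hE0` cancel by `hone` and `hlin`, so only the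
  -- constants survive.
  have ha : a₁ * (∂y v z * ∂x u z) = a₂ := by
    linear_combination h - a₂ * hcube z hz
      - 2 * z.2 ^ 3 * ∂y v z * ∂x u z * hone z hz - z.2 * ∂y v z * ∂x u z * hlin z hz
  have hsq : (∂y v z * ∂x u z) ^ 2 = 1 := by linear_combination - hone z hz
  rcases (by simpa using sq_eq_sq_iff_eq_or_eq_neg.mp (hsq.trans (one_pow 2).symm) :
    ∂y v z * ∂x u z = 1 ∨ ∂y v z * ∂x u z = -1) with h | h
  · left; rw [← ha, h, mul_one]
  · right; rw [← ha, h]; ring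

end Transformation

/-! ### From the equivalence of equations to the transformation equations. -/

/-- A cubic polynomial vanishing off the zero set of a nonzero affine function is zero. -/
theorem cubic_coeffs_eq_zero {𝕜 : Type*} [Field 𝕜] [Infinite 𝕜] {c₀ c₁ c₂ c₃ m n : 𝕜}
    (hmn : m ≠ 0 ∨ n ≠ 0)
    (h : ∀ p, m + p * n ≠ 0 → c₀ + c₁ * p + c₂ * p ^ 2 + c₃ * p ^ 3 = 0) :
    c₀ = 0 ∧ c₁ = 0 ∧ c₂ = 0 ∧ c₃ = 0 := by
  open Polynomial in
  -- The affine factor makes the product vanish at the excluded slope too, hence as a polynomial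
  -- over an infinite field; it is then cancelled.
  have hmul : (C m + X * C n) * (C c₀ + C c₁ * X + C c₂ * X ^ 2 + C c₃ * X ^ 3) = 0 := by
    refine Polynomial.funext fun p => ?_
    by_cases hp : m + p * n = 0
    · simp [mul_comm n p, hp]
    · simp [h p hp]
  rcases mul_eq_zero.mp hmul with h0 | h0
  · have e0 := congrArg (Polynomial.coeff · 0) h0
    have e1 := congrArg (Polynomial.coeff · 1) h0
    simp [Polynomial.coeff_C] at e0 e1
    simp [e0, e1] at hmn
  · have e0 := congrArg (Polynomial.coeff · 0) h0
    have e1 := congrArg (Polynomial.coeff · 1) h0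
    have e2 := congrArg (Polynomial.coeff · 2) h0
    have e3 := congrArg (Polynomial.coeff · 3) h0
    simp [Polynomial.coeff_C, Polynomial.coeff_X, Polynomial.coeff_X_pow] at e0 e1 e2 e3
    exact ⟨e0, e1, e2, e3⟩

section Coordinates

variable {𝕜 : Type*} [RCLike 𝕜] {Φ : 𝕜 × 𝕜 → 𝕜 × 𝕜} {U : Set (𝕜 × 𝕜)} {z : 𝕜 × 𝕜}

theorem fderiv_eq_dirDeriv (hΦ : ContDiffOn 𝕜 ∞ Φ U) (hU : IsOpen U) (hz : z ∈ U) (w : 𝕜 × 𝕜) :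
    fderiv 𝕜 Φ z w =
      (dirDeriv w (fun x => (Φ x).1) z, dirDeriv w (fun x => (Φ x).2) z) := by
  have h : DifferentiableAt 𝕜 Φ z := (hΦ.contDiffAt (hU.mem_nhds hz)).differentiableAt (by simp)
  simp [dirDeriv, fderiv.fst h, fderiv.snd h]

theorem fderiv_fderiv_eq_dirDeriv (hΦ : ContDiffOn 𝕜 ∞ Φ U) (hU : IsOpen U) (hz : z ∈ U)
    (w w' : 𝕜 × 𝕜) : fderiv 𝕜 (fderiv 𝕜 Φ) z w w' =
      (dirDeriv w (dirDeriv w' (fun x => (Φ x).1)) z,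
        dirDeriv w (dirDeriv w' (fun x => (Φ x).2)) z) := by
  have h : DifferentiableAt 𝕜 (fderiv 𝕜 Φ) z :=
    ((hΦ.fderiv_of_isOpen hU (m := ∞) (by simp)).contDiffAt (hU.mem_nhds hz)).differentiableAt
      (by simp)
  have h1 : fderiv 𝕜 (fun x => fderiv 𝕜 Φ x w') z w = fderiv 𝕜 (fderiv 𝕜 Φ) z w w' := by
    rw [fderiv_clm_apply h (differentiableAt_const _)]
    simp
  have h2 : Set.EqOn (fun x => fderiv 𝕜 Φ x w') (fun x =>
      (dirDeriv w' (fun x => (Φ x).1) x, dirDeriv w' (fun x => (Φ x).2) x)) U :=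
    fun x hx => fderiv_eq_dirDeriv hΦ hU hx w'
  rw [← h1, (h2.eventuallyEq_of_mem (hU.mem_nhds hz)).fderiv_eq]
  exact fderiv_eq_dirDeriv ((hΦ.fst.dirDeriv hU w').prodMk (hΦ.snd.dirDeriv hU w')) hU hz w

theorem dirDeriv_one_left (g : 𝕜 × 𝕜 → 𝕜) (p : 𝕜) :
    dirDeriv (1, p) g z = ∂x g z + p * ∂y g z := by
  have : ((1, p) : 𝕜 × 𝕜) = (1, 0) + p • (0, 1) := by simp
  rw [dirDeriv, this, map_add, map_smul]
  rfl

theorem dirDeriv_zero_left (g : 𝕜 × 𝕜 → 𝕜) (q : 𝕜) :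
    dirDeriv (0, q) g z = q * ∂y g z := by
  have : ((0, q) : 𝕜 × 𝕜) = q • (0, 1) := by simp
  rw [dirDeriv, this, map_smul]
  rfl

theorem dirDeriv_dirDeriv_eq {g : 𝕜 × 𝕜 → 𝕜} (hg : ContDiffOn 𝕜 ∞ g U) (hU : IsOpen U)
    (hz : z ∈ U) (p : 𝕜) : dirDeriv (1, p) (dirDeriv (1, p) g) z =
      ∂x (∂x g) z + 2 * p * ∂x (∂y g) z + p ^ 2 * ∂y (∂y g) z := by
  have h : ∀ w, HasDirDeriv w (dirDeriv (1, p) g)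
      (dirDeriv w (∂x g) z + p * dirDeriv w (∂y g) z) z := fun w => by
    have := ((hg.dirDeriv hU (1, 0)).hasDirDeriv hU w hz).add
      (((hg.dirDeriv hU (0, 1)).hasDirDeriv hU w hz).const_mul p)
    convert this using 1
    funext x
    rw [dirDeriv_one_left]
  rw [dirDeriv_one_left, (h _).2, (h _).2, dirDeriv_comm (w := (0, 1)) (w' := (1, 0)) hg hU hz]
  ring

theorem det_fderiv_eq_jacobianDet (hΦ : ContDiffOn 𝕜 ∞ Φ U) (hU : IsOpen U) (hz : z ∈ U) :
    (fderiv 𝕜 Φ z).det = jacobianDet (fun x => (Φ x).1) (fun x => (Φ x).2) z := by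
  rw [ContinuousLinearMap.det, ← LinearMap.det_toMatrix (Module.Basis.finTwoProd 𝕜),
    Matrix.det_fin_two]
  simp [LinearMap.toMatrix_apply, fderiv_eq_dirDeriv hΦ hU hz, jacobianDet]

theorem Transforms.transformationEqs {E₁ E₂ : CubicODE 𝕜} (hΦ : IsPointTransformation Φ U)
    (hT : Transforms Φ U E₁ E₂) (h₁ : ∀ z p, E₁.rhs z p = E₁.P z)
    (h₂ : ∀ z p, E₂.rhs z p = E₂.P z) (hz : z ∈ U) :
    TransformationEqs (fun x => (Φ x).1) (fun x => (Φ x).2) E₁.P (fun x => E₂.P (Φ x)) z := by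
  obtain ⟨hU, hs, hdet⟩ := hΦ
  have hJ := hdet z hz
  rw [det_fderiv_eq_jacobianDet hs hU hz] at hJ
  set u : 𝕜 × 𝕜 → 𝕜 := fun x => (Φ x).1
  set v : 𝕜 × 𝕜 → 𝕜 := fun x => (Φ x).2
  have hmn : ∂x u z ≠ 0 ∨ ∂y u z ≠ 0 := by
    by_contra! h
    exact hJ (by simp [jacobianDet, h.1, h.2])
  have htot : ∀ p, totalDeriv Φ z p = (∂x u z + p * ∂y u z, ∂x v z + p * ∂y v z) := fun p => by
    rw [totalDeriv, fderiv_eq_dirDeriv hs hU hz, dirDeriv_one_left u p, dirDeriv_one_left v p]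
  have htot₂ : ∀ p q, totalDeriv₂ Φ z p q =
      (∂x (∂x u) z + 2 * p * ∂x (∂y u) z + p ^ 2 * ∂y (∂y u) z + q * ∂y u z,
        ∂x (∂x v) z + 2 * p * ∂x (∂y v) z + p ^ 2 * ∂y (∂y v) z + q * ∂y v z) := fun p q => by
    rw [totalDeriv₂, fderiv_fderiv_eq_dirDeriv hs hU hz, fderiv_eq_dirDeriv hs hU hz,
      dirDeriv_dirDeriv_eq hs.fst hU hz, dirDeriv_dirDeriv_eq hs.snd hU hz,
      dirDeriv_zero_left u q, dirDeriv_zero_left v q]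
    rfl
  have key := cubic_coeffs_eq_zero
    (c₀ := ∂x (∂x v) z * ∂x u z - ∂x v z * ∂x (∂x u) z
      + E₁.P z * (∂y v z * ∂x u z - ∂x v z * ∂y u z) - E₂.P (Φ z) * ∂x u z ^ 3)
    (c₁ := 2 * ∂x (∂y v) z * ∂x u z + ∂x (∂x v) z * ∂y u z - 2 * ∂x v z * ∂x (∂y u) z
      - ∂y v z * ∂x (∂x u) z - 3 * E₂.P (Φ z) * ∂x u z ^ 2 * ∂y u z)
    (c₂ := ∂y (∂y v) z * ∂x u z + 2 * ∂x (∂y v) z * ∂y u z - ∂x v z * ∂y (∂y u) z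
      - 2 * ∂y v z * ∂x (∂y u) z - 3 * E₂.P (Φ z) * ∂x u z * ∂y u z ^ 2)
    (c₃ := ∂y (∂y v) z * ∂y u z - ∂y v z * ∂y (∂y u) z - E₂.P (Φ z) * ∂y u z ^ 3)
    hmn (fun p hp => by
      have hp' : (totalDeriv Φ z p).1 ≠ 0 := by rwa [htot]
      -- Taking `q` on the source equation and clearing the denominator `(dx̃/dx)³` gives a cubic in
      -- `p`, as neither right-hand side depends on the slope.
      have h := (hT z hz p (E₁.P z) hp').mp (h₁ z p).symm
      rw [h₂, newSecond, div_eq_iff (pow_ne_zero 3 hp'), htot, htot₂] at h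
      linear_combination h)
  obtain ⟨k0, k1, k2, k3⟩ := key
  exact ⟨sub_eq_zero.mp k0, sub_eq_zero.mp k1, sub_eq_zero.mp k2, sub_eq_zero.mp k3⟩

end Coordinates

/-! ### The nonequivalence theorem. -/

theorem lemma1 {𝕜 : Type*} [RCLike 𝕜] (a₁ a₂ : 𝕜) (h_pos : a₁ ≠ a₂) (h_neg : a₁ ≠ -a₂) :
    ¬ PointEquivalent (painleveII a₁) (painleveII a₂) := by
  rintro ⟨U, Φ, hne, hΦ, hT⟩
  have hrhs : ∀ (a : 𝕜) z p, (painleveII a).rhs z p = (painleveII a).P z := fun a z p => by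
    simp [CubicODE.rhs, painleveII]
  have hE := fun z hz => hT.transformationEqs (z := z) hΦ (hrhs a₁) (hrhs a₂) hz
  obtain ⟨hU, hs, hdet⟩ := hΦ
  have hJ : ∀ z ∈ U, jacobianDet (fun x => (Φ x).1) (fun x => (Φ x).2) z ≠ 0 := fun z hz => by
    rw [← det_fderiv_eq_jacobianDet hs hU hz]
    exact hdet z hz
  have hprod := fun z hz =>
    snd_mul_dirDeriv_eq_zero (a₂ := a₂) (z := z) hU hs.fst hs.snd hJ hE hz
  -- If `v` vanished throughout `U`, so would its gradient, and hence the Jacobian.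
  have hVne : (U ∩ {z | (Φ z).2 ≠ 0}).Nonempty := by
    by_contra hempty
    have h0 : Set.EqOn (fun x => (Φ x).2) (fun _ => 0) U := fun z hz => by
      by_contra h
      exact hempty ⟨z, hz, h⟩
    obtain ⟨z, hz⟩ := hne
    exact hJ z hz (by simp [jacobianDet, dirDeriv_eq_zero_of_eqOn hU hz h0])
  have hV : IsOpen (U ∩ {z | (Φ z).2 ≠ 0}) :=
    hs.snd.continuousOn.isOpen_inter_preimage hU isOpen_compl_singleton
  have hVU : U ∩ {z | (Φ z).2 ≠ 0} ⊆ U := Set.inter_subset_left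
  rcases eq_or_eq_neg_of_dirDeriv_eq_zero (a₁ := a₁) (a₂ := a₂) hV hVne (hs.fst.mono hVU)
    (hs.snd.mono hVU) (fun z hz => hJ z hz.1) (fun z hz => hE z hz.1)
    (fun z hz => (mul_eq_zero.mp (hprod z hz.1)).resolve_left hz.2) with h | h
  · exact h_pos h
  · exact h_neg h
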